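/- Let $D\in\mathbb N$, $\sigma>0$, $m>0$, and let $\gamma^D=\mathcal N(0,\mathbf I_D)$. Let $P$ be a probability distribution on $\mathbb R^D$ with a Lebesgue density $\pi$ that is $m$-strongly log-concave, i.e. $\{\pi>0\}$ is convex and $\log\pi(ax+by)\ge a\log\pi(x)+b\log\pi(y)+\tfrac m2\,ab\,\|x-y\|^2$ for all $x,y\in\{\pi>0\}$ and all $a,b\ge 0$ with $a+b=1$. Let $(X,\xi)\sim P\otimes\gamma^D$. For $y\in\mathbb R^D$ let the conditional distribution of $X$ given $X+\sigma\xi=y$ be the one given by Bayes' formula, i.e. the probability measure whose density with respect to $P$ is proportional to $x\mapsto\exp\!\big(-\|y-x\|^2/(2\sigma^2)\big)$. This is a version of the regular conditional distribution of $X$ given $X+\sigma\xi$, and it has a finite second moment for every $y$. Let $\operatorname{Var}(X\mid X+\sigma\xi=y)$ be its covariance matrix. Then, in the Loewner order, $$\operatorname{Var}(X\mid X+\sigma\xi=y)\preccurlyeq\frac{\sigma^2}{1+m\sigma^2}\,\mathbf I_D\qquad\text{for all }y\in\mathbb R^D.$$ If in addition $\pi$ is everywhere positive, $\log\pi$ is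 differentiable on $\mathbb R^D$, and the score $x\mapsto\nabla\log\pi(x)$ is $M$-Lipschitz on $\mathbb R^D$ for some $M>0$, then $$\operatorname{Var}(X\mid X+\sigma\xi=y)\succcurlyeq\frac{\sigma^2}{1+M\sigma^2}\,\mathbf I_D\qquad\text{for all }y\in\mathbb R^D.$$ -/

import Mathlib

open MeasureTheory ProbabilityTheory
open scoped NNReal

noncomputable section

/-- A nonnegative function `p` on `ℝ^D` is `m`-strongly log-concave if `-log p`, with value `+∞`
where `p` vanishes, is `m`-strongly convex: `{p > 0}` is convex and, for `x, y` in it and `a, b ≥ 0`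
with `a + b = 1`,
`a * log (p x) + b * log (p y) + a * b * (m / 2) * ‖x - y‖ ^ 2 ≤ log (p (a • x + b • y))`. -/
def IsStronglyLogConcave {D : ℕ} (m : ℝ) (p : EuclideanSpace ℝ (Fin D) → ℝ) : Prop :=
  (∀ x, 0 ≤ p x) ∧ StrongConcaveOn {x | 0 < p x} m (fun x => Real.log (p x))

/-- The score `∇ log p` is defined on the whole of `ℝ^D` and is `M`-Lipschitz there. -/
def HasLipschitzScore {D : ℕ} (M : ℝ≥0) (p : EuclideanSpace ℝ (Fin D) → ℝ) : Prop :=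
  (∀ x, 0 < p x) ∧ Differentiable ℝ (fun x => Real.log (p x)) ∧
    LipschitzWith M (gradient (fun x => Real.log (p x)))

/-- The conditional distribution of `X` given `X + σ ξ = y`, for `(X, ξ)` with law `P ⊗ N(0, I)`,
given for every `y` by Bayes' formula: it has density proportional to
`x ↦ exp (-‖y - x‖ ^ 2 / (2 σ ^ 2))` with respect to `P`. -/
def gaussianPosterior {D : ℕ} (P : Measure (EuclideanSpace ℝ (Fin D))) (σ : ℝ)
    (y : EuclideanSpace ℝ (Fin D)) : Measure (EuclideanSpace ℝ (Fin D)) :=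
  P.tilted (fun x => -‖y - x‖ ^ 2 / (2 * σ ^ 2))

/-- The covariance matrix of a distribution on `ℝ^D`. -/
def covMatrix {D : ℕ} (ν : Measure (EuclideanSpace ℝ (Fin D))) : Matrix (Fin D) (Fin D) ℝ :=
  Matrix.of fun i j => covariance (fun x => x i) (fun x => x j) ν

end

/-!
The posterior of `X` given `X + σ ξ = y` has the explicit Lebesgue density
`q x ∝ p x * exp (-‖y - x‖² / (2 σ²))` (`gaussianPosteriorDensity`). By the parallelogram law its
Gaussian factor adds exactly `1 / σ²` both to the constant of strong log-concavity of `p` and to the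
Lipschitz constant of its score. So, with `κ = m + 1 / σ²` and `L = M + 1 / σ²`, it is enough to
bound the variance of a linear functional `W = ⟪v, ·⟫` under `q` by `‖v‖² / κ` from above and by
`‖v‖² / L` from below.

*Upper bound.* The Prékopa–Leindler inequality for midpoints
(`satisfiesPrekopaLeindler_euclideanSpace`) is applied to `q e^{tW}`, `q e^{-tW}` and
`q e^{t²‖v‖²/(2κ)}`. It bounds the moment generating function of `W - W'`, with `W'` an independent
copy of `W`, by `e^{t²‖v‖²/κ}`; comparing second-order terms as `t → 0` gives
`2 Var W ≤ 2 ‖v‖² / κ` (`variance_le_of_lintegral_exp_mul_le`). The Prékopa–Leindler inequality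
itself follows on `ℝ` from the Brunn–Minkowski inequality for superlevel sets, and it passes to
products.

*Lower bound.* This is a Cramér–Rao bound, in its Hammersley–Chapman–Robbins form, which needs
no integration by parts (`norm_sq_div_le_variance_inner`). The likelihood ratio
`r x = q (x + t v) / q x` satisfies `Cov (W, r) = -t ‖v‖²`, and log-smoothness,
`q (x + t v)² ≤ q x * q (x + 2 t v) * e^{L t² ‖v‖²}`, yields `E r² ≤ e^{L t² ‖v‖²}`. The claim is
the limit as `t → 0` of `Var (W + r / (L t)) ≥ 0`.

*Conditional law.* The law of `σ ξ` has a Gaussian density, identified by its characteristic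
function (`map_smul_stdGaussian_eq_withDensity`), so the joint law of `(X + σ ξ, X)` has a density
with respect to `volume ⊗ P`, and normalizing that density in `x` disintegrates the joint law
(`withDensity_eq_fst_compProd`).
-/

open scoped ENNReal Pointwise RealInnerProductSpace

/-! ### The Prékopa–Leindler inequality -/

/-- One-dimensional Brunn–Minkowski inequality for compact sets: `A + B` contains the translates
`A + min B` and `max A + B`, which meet in a single point. -/
theorem volume_add_volume_le_of_isCompact {A B C : Set ℝ} (hA : IsCompact A) (hB : IsCompact B)
    (hA' : A.Nonempty) (hB' : B.Nonempty) (h : A + B ⊆ C) :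
    volume A + volume B ≤ volume C := by
  obtain ⟨a, haA, ha⟩ := hA.exists_isGreatest hA'
  obtain ⟨b, hbB, hb⟩ := hB.exists_isLeast hB'
  have hdisj : AEDisjoint volume ((fun x => x + b) '' A) ((fun x => a + x) '' B) := by
    refine measure_mono_null (t := {a + b}) ?_ (by simp)
    rintro _ ⟨⟨x, hx, rfl⟩, ⟨y, hy, hxy⟩⟩
    have h1 := ha hx
    have h2 := hb hy
    change a + y = x + b at hxy
    simp only [Set.mem_singleton_iff]
    linarith
  have hBm : MeasurableSet ((fun x => a + x) '' B) :=
    (hB.image (by fun_prop)).measurableSet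
  calc volume A + volume B
      = volume ((fun x => x + b) '' A) + volume ((fun x => a + x) '' B) := by
        simp [Set.image_add_right, Set.image_add_left, measure_preimage_add_right,
          measure_preimage_add]
    _ = volume ((fun x => x + b) '' A ∪ (fun x => a + x) '' B) :=
        (measure_union₀ hBm.nullMeasurableSet hdisj).symm
    _ ≤ volume C := by
        refine measure_mono (Set.Subset.trans ?_ h)
        rintro _ (⟨x, hx, rfl⟩ | ⟨x, hx, rfl⟩)
        · exact Set.add_mem_add hx hbB
        · exact Set.add_mem_add haA hx

theorem volume_add_volume_le {A B C : Set ℝ} (hA : MeasurableSet A) (hB : MeasurableSet B)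
    (hA' : A.Nonempty) (hB' : B.Nonempty) (h : A + B ⊆ C) :
    volume A + volume B ≤ volume C := by
  obtain ⟨a, ha⟩ := hA'
  obtain ⟨b, hb⟩ := hB'
  rw [hA.measure_eq_iSup_isCompact, hB.measure_eq_iSup_isCompact]
  simp_rw [iSup_and']
  refine ENNReal.biSup_add_biSup_le' ⟨∅, by simp⟩ ⟨∅, by simp⟩ fun K hK L hL => ?_
  -- adjoining a point makes the compact subsets nonempty
  exact (add_le_add (measure_mono (Set.subset_insert a K))
    (measure_mono (Set.subset_insert b L))).trans
    (volume_add_volume_le_of_isCompact (hK.2.insert a) (hL.2.insert b) (by simp) (by simp)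
      ((Set.add_subset_add (Set.insert_subset ha hK.1) (Set.insert_subset hb hL.1)).trans h))

/-- The layer cake formula for functions with values in `[0, 1]`. -/
theorem lintegral_eq_lintegral_meas_lt_of_le_one {f : ℝ → ℝ≥0∞} (hf : Measurable f)
    (hf1 : ∀ x, f x ≤ 1) :
    ∫⁻ x, f x = ∫⁻ t in Set.Ioo (0 : ℝ) 1, volume {x | ENNReal.ofReal t < f x} := by
  have hfin : ∀ x, f x ≠ ∞ := fun x => ne_top_of_le_ne_top ENNReal.one_ne_top (hf1 x)
  have h := lintegral_eq_lintegral_meas_lt (volume : Measure ℝ) (f := fun x => (f x).toReal)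
    (Filter.Eventually.of_forall fun x => ENNReal.toReal_nonneg) hf.ennreal_toReal.aemeasurable
  simp only [ENNReal.ofReal_toReal (hfin _)] at h
  rw [h, ← Set.Ioo_union_Ici_eq_Ioi (zero_lt_one' ℝ), lintegral_union measurableSet_Ici
    (Set.disjoint_left.2 fun x hx hx' => not_le.2 hx.2 hx')]
  have h0 : ∫⁻ t in Set.Ici (1 : ℝ), volume {x | t < (f x).toReal} = 0 := by
    rw [setLIntegral_congr_fun (g := fun _ => 0) measurableSet_Ici]
    · simp
    · intro t ht
      have : {x | t < (f x).toReal} = ∅ := by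
        ext x
        simp only [Set.mem_ofPred_eq, Set.mem_empty_iff_false, iff_false, not_lt]
        exact (ENNReal.toReal_mono ENNReal.one_ne_top (hf1 x)).trans (by simpa using ht)
      simp [this]
  rw [h0, add_zero]
  refine setLIntegral_congr_fun measurableSet_Ioo fun t ht => ?_
  simp only [ENNReal.ofReal_lt_iff_lt_toReal ht.1.le (hfin _)]

/-- If `f` and `g` have supremum `1`, the superlevel sets of `f` and `g` at the same height are
both nonempty, so that the Brunn–Minkowski inequality applies to them. -/
theorem lintegral_add_lintegral_le_of_iSup_eq_one {f g h : ℝ → ℝ≥0∞} (hf : Measurable f)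
    (hg : Measurable g) (hh : Measurable h) (hf1 : ⨆ x, f x = 1) (hg1 : ⨆ x, g x = 1)
    (hfg : ∀ x y, f x * g y ≤ h ((2⁻¹ : ℝ) • (x + y)) ^ 2) :
    (∫⁻ x, f x) + ∫⁻ x, g x ≤ 2 * ∫⁻ x, h x := by
  have hfle : ∀ x, f x ≤ 1 := fun x => hf1 ▸ le_iSup f x
  have hgle : ∀ x, g x ≤ 1 := fun x => hg1 ▸ le_iSup g x
  -- truncating `h` at `1` loses nothing, as only heights `t < 1` matter
  have hmono : ∫⁻ x, min (h x) 1 ≤ ∫⁻ x, h x := lintegral_mono fun x => min_le_left _ _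
  refine le_trans ?_ (mul_le_mul_right hmono 2)
  rw [lintegral_eq_lintegral_meas_lt_of_le_one hf hfle,
    lintegral_eq_lintegral_meas_lt_of_le_one hg hgle,
    lintegral_eq_lintegral_meas_lt_of_le_one (hh.min measurable_const) (fun x => min_le_right _ _),
    ← lintegral_const_mul' _ _ (by simp), ← lintegral_add_left']
  · refine setLIntegral_mono' measurableSet_Ioo fun t ht => ?_
    have ht1 : ENNReal.ofReal t < 1 := by simpa using ht.2
    obtain ⟨x, hx⟩ := lt_iSup_iff.1 (hf1 ▸ ht1)
    obtain ⟨y, hy⟩ := lt_iSup_iff.1 (hg1 ▸ ht1)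
    have h2 : (2 : ℝ≥0∞) * volume {x | ENNReal.ofReal t < min (h x) 1}
        = volume ((2 : ℝ) • {x | ENNReal.ofReal t < min (h x) 1}) := by
      simp [Measure.addHaar_smul]
    rw [h2]
    refine volume_add_volume_le (measurableSet_lt measurable_const hf)
      (measurableSet_lt measurable_const hg) ⟨x, hx⟩ ⟨y, hy⟩ ?_
    rintro _ ⟨u, hu, v, hv, rfl⟩
    refine ⟨(2⁻¹ : ℝ) • (u + v), ?_, by simp⟩
    simp only [Set.mem_ofPred_eq, lt_min_iff] at hu hv ⊢
    refine ⟨?_, ht1⟩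
    have : ENNReal.ofReal t ^ 2 < h ((2⁻¹ : ℝ) • (u + v)) ^ 2 := by
      refine lt_of_lt_of_le ?_ (hfg u v)
      rw [sq]
      exact ENNReal.mul_lt_mul hu hv
    exact lt_of_pow_lt_pow_left' 2 this
  · refine Antitone.measurable (fun s t hst => measure_mono fun x hx => ?_) |>.aemeasurable
    exact lt_of_le_of_lt (ENNReal.ofReal_le_ofReal hst) hx

theorem ENNReal.four_mul_le_add_sq (x y : ℝ≥0∞) : 4 * (x * y) ≤ (x + y) ^ 2 := by
  wlog hxy : x ≤ y generalizing x y
  · rw [mul_comm x, add_comm x]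
    exact this y x (le_of_not_ge hxy)
  obtain ⟨d, rfl⟩ := exists_add_of_le hxy
  calc 4 * (x * (x + d)) ≤ 4 * (x * (x + d)) + d ^ 2 := le_self_add
    _ = (x + (x + d)) ^ 2 := by ring

/-- Dividing `f`, `g` and `h` by `sup f`, `sup g` and `√(sup f * sup g)` reduces the product form
of the inequality to the sum form for functions with supremum `1`. -/
theorem lintegral_mul_lintegral_le_of_iSup_lt_top {f g h : ℝ → ℝ≥0∞} (hf : Measurable f)
    (hg : Measurable g) (hh : Measurable h) (hf1 : ⨆ x, f x ≠ ∞) (hg1 : ⨆ x, g x ≠ ∞)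
    (hfg : ∀ x y, f x * g y ≤ h ((2⁻¹ : ℝ) • (x + y)) ^ 2) :
    (∫⁻ x, f x) * ∫⁻ x, g x ≤ (∫⁻ x, h x) ^ 2 := by
  set a := ⨆ x, f x with ha
  set b := ⨆ x, g x with hb
  rcases eq_or_ne a 0 with ha0 | ha0
  · have : ∀ x, f x = 0 := fun x => le_antisymm (ha0 ▸ le_iSup f x) zero_le
    simp [this]
  rcases eq_or_ne b 0 with hb0 | hb0
  · have : ∀ x, g x = 0 := fun x => le_antisymm (hb0 ▸ le_iSup g x) zero_le
    simp [this]
  set c := (a * b) ^ (2⁻¹ : ℝ) with hc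
  have hab0 : a * b ≠ 0 := mul_ne_zero ha0 hb0
  have habt : a * b ≠ ∞ := ENNReal.mul_ne_top hf1 hg1
  have hc2 : c ^ 2 = a * b := by
    rw [hc, ← ENNReal.rpow_natCast, ← ENNReal.rpow_mul]; simp
  have hc0 : c ≠ 0 := fun h0 => hab0 (by rw [← hc2, h0]; simp)
  have hct : c ≠ ∞ := fun h0 => habt (by rw [← hc2, h0]; simp)
  have key := lintegral_add_lintegral_le_of_iSup_eq_one (f := fun x => a⁻¹ * f x)
    (g := fun x => b⁻¹ * g x) (h := fun x => c⁻¹ * h x) (hf.const_mul _) (hg.const_mul _)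
    (hh.const_mul _) (by rw [← ENNReal.mul_iSup, ← ha, ENNReal.inv_mul_cancel ha0 hf1])
    (by rw [← ENNReal.mul_iSup, ← hb, ENNReal.inv_mul_cancel hb0 hg1]) (fun x y => by
      rw [mul_pow, ← ENNReal.inv_pow, hc2, ENNReal.mul_inv (.inl ha0) (.inl hf1)]
      calc a⁻¹ * f x * (b⁻¹ * g y) = a⁻¹ * b⁻¹ * (f x * g y) := by ring
        _ ≤ _ := by gcongr; exact hfg x y)
  rw [lintegral_const_mul _ hf, lintegral_const_mul _ hg, lintegral_const_mul _ hh] at key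
  set F := ∫⁻ x, f x
  set G := ∫⁻ x, g x
  set H := ∫⁻ x, h x
  have h4 : 4 * ((a⁻¹ * F) * (b⁻¹ * G)) ≤ 4 * (c⁻¹ * H) ^ 2 :=
    (ENNReal.four_mul_le_add_sq _ _).trans ((pow_le_pow_left' key 2).trans_eq (by ring))
  rw [ENNReal.mul_le_mul_iff_right (by simp) (by simp)] at h4
  calc F * G = (a * a⁻¹) * (b * b⁻¹) * (F * G) := by
        rw [ENNReal.mul_inv_cancel ha0 hf1, ENNReal.mul_inv_cancel hb0 hg1]; simp
    _ = (a * b) * ((a⁻¹ * F) * (b⁻¹ * G)) := by ring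
    _ ≤ (a * b) * (c⁻¹ * H) ^ 2 := by gcongr
    _ = (c * c⁻¹) ^ 2 * H ^ 2 := by rw [← hc2]; ring
    _ = H ^ 2 := by rw [ENNReal.mul_inv_cancel hc0 hct]; simp

/-- The measure `μ` satisfies the Prékopa–Leindler inequality for midpoints. -/
def SatisfiesPrekopaLeindler {E : Type*} [AddCommGroup E] [Module ℝ E] [MeasurableSpace E]
    (μ : Measure E) : Prop :=
  ∀ f g h : E → ℝ≥0∞, Measurable f → Measurable g → Measurable h →
    (∀ x y, f x * g y ≤ h ((2⁻¹ : ℝ) • (x + y)) ^ 2) →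
    (∫⁻ x, f x ∂μ) * ∫⁻ x, g x ∂μ ≤ (∫⁻ x, h x ∂μ) ^ 2

theorem lintegral_eq_iSup_lintegral_min {α : Type*} [MeasurableSpace α] {μ : Measure α}
    {f : α → ℝ≥0∞} (hf : Measurable f) :
    ∫⁻ x, f x ∂μ = ⨆ n : ℕ, ∫⁻ x, min (f x) n ∂μ := by
  rw [← lintegral_iSup (fun n => hf.min measurable_const)]
  · refine lintegral_congr fun x => ?_
    refine le_antisymm ?_ (iSup_le fun n => min_le_left _ _)
    rw [← inf_iSup_eq, ENNReal.iSup_natCast]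
    simp
  · intro i j hij x
    exact min_le_min le_rfl (by exact_mod_cast hij)

/-- Truncation reduces the general case to bounded `f` and `g`. -/
theorem satisfiesPrekopaLeindler_real : SatisfiesPrekopaLeindler (volume : Measure ℝ) := by
  intro f g h hf hg hh hfg
  refine ENNReal.mul_le_of_forall_lt fun r hr s hs => ?_
  rw [lintegral_eq_iSup_lintegral_min hf, lt_iSup_iff] at hr
  rw [lintegral_eq_iSup_lintegral_min hg, lt_iSup_iff] at hs
  obtain ⟨n, hn⟩ := hr
  obtain ⟨k, hk⟩ := hs
  refine (mul_le_mul' hn.le hk.le).trans ?_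
  refine lintegral_mul_lintegral_le_of_iSup_lt_top (hf.min measurable_const)
    (hg.min measurable_const) hh ?_ ?_ fun x y =>
      (mul_le_mul' (min_le_left _ _) (min_le_left _ _)).trans (hfg x y)
  · exact ne_top_of_le_ne_top (ENNReal.natCast_ne_top n) (iSup_le fun x => min_le_right _ _)
  · exact ne_top_of_le_ne_top (ENNReal.natCast_ne_top k) (iSup_le fun x => min_le_right _ _)

/-- The inequality on the second factor turns the hypothesis on `E × F` into the hypothesis for the
partial integrals on `E`. -/
theorem SatisfiesPrekopaLeindler.prod {E F : Type*} [AddCommGroup E] [Module ℝ E]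
    [MeasurableSpace E] [AddCommGroup F] [Module ℝ F] [MeasurableSpace F] {μ : Measure E}
    {ν : Measure F} [SFinite ν] (hμ : SatisfiesPrekopaLeindler μ)
    (hν : SatisfiesPrekopaLeindler ν) : SatisfiesPrekopaLeindler (μ.prod ν) := by
  intro f g h hf hg hh hfg
  rw [lintegral_prod _ hf.aemeasurable, lintegral_prod _ hg.aemeasurable,
    lintegral_prod _ hh.aemeasurable]
  refine hμ _ _ _ hf.lintegral_prod_right' hg.lintegral_prod_right' hh.lintegral_prod_right' ?_
  intro x y
  refine hν _ _ _ (hf.comp measurable_prodMk_left) (hg.comp measurable_prodMk_left)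
    (hh.comp measurable_prodMk_left) fun u v => ?_
  simpa using hfg (x, u) (y, v)

theorem SatisfiesPrekopaLeindler.of_measurableEquiv {E F : Type*} [AddCommGroup E] [Module ℝ E]
    [MeasurableSpace E] [AddCommGroup F] [Module ℝ F] [MeasurableSpace F] {μ : Measure E}
    {ν : Measure F} (hμ : SatisfiesPrekopaLeindler μ) (e : E ≃ᵐ F) (he : MeasurePreserving e μ ν)
    (hlin : ∀ x y, e ((2⁻¹ : ℝ) • (x + y)) = (2⁻¹ : ℝ) • (e x + e y)) :
    SatisfiesPrekopaLeindler ν := by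
  intro f g h hf hg hh hfg
  rw [← he.lintegral_comp hf, ← he.lintegral_comp hg, ← he.lintegral_comp hh]
  refine hμ _ _ _ (hf.comp e.measurable) (hg.comp e.measurable) (hh.comp e.measurable) ?_
  intro x y
  rw [hlin]
  exact hfg _ _

theorem satisfiesPrekopaLeindler_pi (n : ℕ) :
    SatisfiesPrekopaLeindler (volume : Measure (Fin n → ℝ)) := by
  induction n with
  | zero =>
    intro f g h hf hg hh hfg
    rw [Measure.volume_pi_eq_dirac 0]
    simpa [lintegral_dirac] using hfg 0 0
  | succ n ih =>
    refine (satisfiesPrekopaLeindler_real.prod ih).of_measurableEquiv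
      (MeasurableEquiv.piFinSuccAbove (fun _ => ℝ) 0).symm
      (volume_preserving_piFinSuccAbove (fun _ => ℝ) 0).symm fun x y => ?_
    ext i
    refine Fin.cases ?_ (fun j => ?_) i <;>
    simp [MeasurableEquiv.piFinSuccAbove, Fin.insertNthEquiv, mul_add]

theorem satisfiesPrekopaLeindler_euclideanSpace (n : ℕ) :
    SatisfiesPrekopaLeindler (volume : Measure (EuclideanSpace ℝ (Fin n))) :=
  (satisfiesPrekopaLeindler_pi n).of_measurableEquiv (MeasurableEquiv.toLp 2 (Fin n → ℝ))
    (PiLp.volume_preserving_toLp (Fin n)) fun _ _ => rfl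

/-! ### Variance of linear functionals under strong log-concavity -/

/-- The Prékopa–Leindler inequality for `q e^{t⟪v, ·⟫}`, `q e^{-t⟪v, ·⟫}` and a multiple of `q`:
the gain `κ ‖x - y‖² / 4` in the midpoint inequality absorbs the linear term `t⟪v, x - y⟫`. -/
theorem lintegral_exp_mul_lintegral_exp_neg_le {D : ℕ} {q : EuclideanSpace ℝ (Fin D) → ℝ}
    (hq : Measurable q) (hq0 : ∀ x, 0 ≤ q x)
    (hq1 : IsProbabilityMeasure (volume.withDensity fun x => ENNReal.ofReal (q x)))
    {κ : ℝ} (hκ : 0 < κ)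
    (hmid : ∀ x y, q x * q y ≤ q ((2⁻¹ : ℝ) • (x + y)) ^ 2 * Real.exp (-(κ / 4 * ‖x - y‖ ^ 2)))
    (v : EuclideanSpace ℝ (Fin D)) (t : ℝ) :
    (∫⁻ x, ENNReal.ofReal (Real.exp (t * ⟪v, x⟫))
        ∂volume.withDensity fun x => ENNReal.ofReal (q x)) *
      (∫⁻ x, ENNReal.ofReal (Real.exp (-(t * ⟪v, x⟫)))
        ∂volume.withDensity fun x => ENNReal.ofReal (q x))
      ≤ ENNReal.ofReal (Real.exp (t ^ 2 * ‖v‖ ^ 2 / κ)) := by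
  have hqm : Measurable fun x => ENNReal.ofReal (q x) := hq.ennreal_ofReal
  have h1 : ∫⁻ x, ENNReal.ofReal (q x) = 1 := by
    rw [← hq1.measure_univ, withDensity_apply _ MeasurableSet.univ, setLIntegral_univ]
  rw [lintegral_withDensity_eq_lintegral_mul _ hqm (by fun_prop),
    lintegral_withDensity_eq_lintegral_mul _ hqm (by fun_prop)]
  set c : ℝ := Real.exp (t ^ 2 * ‖v‖ ^ 2 / (2 * κ)) with hc
  have key := satisfiesPrekopaLeindler_euclideanSpace D
    ((fun x => ENNReal.ofReal (q x)) * fun x => ENNReal.ofReal (Real.exp (t * ⟪v, x⟫)))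
    ((fun x => ENNReal.ofReal (q x)) * fun x => ENNReal.ofReal (Real.exp (-(t * ⟪v, x⟫))))
    (fun x => ENNReal.ofReal c * ENNReal.ofReal (q x)) (hqm.mul (by fun_prop))
    (hqm.mul (by fun_prop)) (hqm.const_mul _) ?_
  · refine key.trans_eq ?_
    rw [lintegral_const_mul _ hqm, h1, mul_one, ← ENNReal.ofReal_pow (Real.exp_nonneg _),
      ← Real.exp_nat_mul]
    congr 2
    push_cast
    field_simp
  · intro x y
    simp only [Pi.mul_apply]
    rw [← ENNReal.ofReal_mul (hq0 _), ← ENNReal.ofReal_mul (hq0 _),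
      ← ENNReal.ofReal_mul (by have := hq0 x; positivity), ← ENNReal.ofReal_mul (Real.exp_nonneg _),
      ← ENNReal.ofReal_pow (mul_nonneg (Real.exp_nonneg _) (hq0 _))]
    refine ENNReal.ofReal_le_ofReal ?_
    -- `0 ≤ ‖t v - (κ / 2) (x - y)‖²`
    have hlin : t * ⟪v, x⟫ + -(t * ⟪v, y⟫) + -(κ / 4 * ‖x - y‖ ^ 2) ≤ t ^ 2 * ‖v‖ ^ 2 / κ := by
      have h0 : 0 ≤ ‖t • v - (κ / 2) • (x - y)‖ ^ 2 := by positivity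
      rw [norm_sub_sq_real, norm_smul, norm_smul, inner_smul_left, inner_smul_right,
        inner_sub_right, mul_pow, mul_pow, Real.norm_eq_abs, Real.norm_eq_abs, sq_abs, sq_abs] at h0
      simp only [conj_trivial] at h0
      rw [le_div_iff₀ hκ]
      nlinarith
    calc q x * Real.exp (t * ⟪v, x⟫) * (q y * Real.exp (-(t * ⟪v, y⟫)))
        = q x * q y * Real.exp (t * ⟪v, x⟫ + -(t * ⟪v, y⟫)) := by rw [Real.exp_add]; ring
      _ ≤ q ((2⁻¹ : ℝ) • (x + y)) ^ 2 * Real.exp (-(κ / 4 * ‖x - y‖ ^ 2)) *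
          Real.exp (t * ⟪v, x⟫ + -(t * ⟪v, y⟫)) := 
          mul_le_mul_of_nonneg_right (hmid x y) (Real.exp_nonneg _)
      _ = q ((2⁻¹ : ℝ) • (x + y)) ^ 2 *
          Real.exp (t * ⟪v, x⟫ + -(t * ⟪v, y⟫) + -(κ / 4 * ‖x - y‖ ^ 2)) := by
          rw [Real.exp_add _ (-(κ / 4 * ‖x - y‖ ^ 2))]; ring
      _ ≤ q ((2⁻¹ : ℝ) • (x + y)) ^ 2 * Real.exp (t ^ 2 * ‖v‖ ^ 2 / κ) := by gcongr
      _ = (c * q ((2⁻¹ : ℝ) • (x + y))) ^ 2 := by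
          rw [mul_pow, hc, ← Real.exp_nat_mul, mul_comm]
          congr 2
          push_cast
          field_simp

theorem tendsto_exp_mul_sub_one_div (c : ℝ) :
    Filter.Tendsto (fun s : ℝ => (Real.exp (c * s) - 1) / s) (nhdsWithin 0 (Set.Ioi 0))
      (nhds c) := by
  have h : HasDerivAt (fun s : ℝ => Real.exp (c * s)) c 0 := by
    simpa using ((hasDerivAt_id (0 : ℝ)).const_mul c).exp
  simpa [div_eq_inv_mul] using h.tendsto_slope_zero_right

theorem two_add_sq_le_exp_add_exp_neg (u : ℝ) : 2 + u ^ 2 ≤ Real.exp u + Real.exp (-u) := by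
  have h1 : |u / 2| ≤ |Real.sinh (u / 2)| := by
    rw [Real.abs_sinh]
    exact Real.self_le_sinh_iff.2 (abs_nonneg _)
  have h2 := sq_le_sq.2 h1
  have h3 := Real.cosh_two_mul (u / 2)
  have h4 := Real.cosh_sq (u / 2)
  rw [mul_div_cancel₀ _ (two_ne_zero), Real.cosh_eq] at h3
  nlinarith

/-- If the symmetrization `X - X'` of a random variable `X`, with `X'` an independent copy of `X`,
has a moment generating function bounded by `exp (c t²)`, then `Var X ≤ c`. -/
theorem variance_le_of_lintegral_exp_mul_le {α : Type*} [MeasurableSpace α] {ν : Measure α}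
    [IsProbabilityMeasure ν] {W : α → ℝ} (hW : Measurable W) (hW2 : MemLp W 2 ν) {c : ℝ}
    (h : ∀ t : ℝ, (∫⁻ x, ENNReal.ofReal (Real.exp (t * W x)) ∂ν) *
      (∫⁻ x, ENNReal.ofReal (Real.exp (-(t * W x))) ∂ν) ≤ ENNReal.ofReal (Real.exp (c * t ^ 2))) :
    Var[W; ν] ≤ c := by
  set U : α × α → ℝ := fun z => W z.1 + -W z.2 with hU
  have hUm : Measurable U := by fun_prop
  have hWint : Integrable W ν := hW2.integrable (by norm_num)
  have hU2 : MemLp U 2 (ν.prod ν) := (hW2.comp_fst ν).add (hW2.neg.comp_snd ν)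
  have hU0 : ∫ z, U z ∂(ν.prod ν) = 0 := by
    refine (integral_add (hWint.comp_fst ν) (hWint.neg.comp_snd ν)).trans ?_
    simp [integral_fun_fst, integral_neg, integral_fun_snd]
  have hUv : ∫ z, U z ^ 2 ∂(ν.prod ν) = 2 * Var[W; ν] := by
    rw [← variance_of_integral_eq_zero hUm.aemeasurable hU0, hU,
      variance_add_prod (Y := fun x => -W x) hW2 hW2.neg, variance_fun_neg]
    ring
  have hexp : ∀ t : ℝ, ∫⁻ z, ENNReal.ofReal (Real.exp (t * U z)) ∂(ν.prod ν)
      ≤ ENNReal.ofReal (Real.exp (c * t ^ 2)) := by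
    intro t
    refine le_trans (le_of_eq ?_) (h t)
    rw [← lintegral_prod_mul (by fun_prop) (by fun_prop)]
    refine lintegral_congr fun z => ?_
    rw [← ENNReal.ofReal_mul (Real.exp_nonneg _), ← Real.exp_add]
    simp only [hU]
    ring_nf
  have hineq : ∀ t : ℝ, 1 + t ^ 2 * Var[W; ν] ≤ Real.exp (c * t ^ 2) := by
    intro t
    have hint : Integrable (fun z => 2 + (t * U z) ^ 2) (ν.prod ν) := by
      simp_rw [mul_pow]
      exact (integrable_const _).add (hU2.integrable_sq.const_mul _)
    have h1 : ENNReal.ofReal (∫ z, (2 + (t * U z) ^ 2) ∂(ν.prod ν))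
        ≤ ENNReal.ofReal (2 * Real.exp (c * t ^ 2)) := by
      rw [ofReal_integral_eq_lintegral_ofReal hint
        (Filter.Eventually.of_forall fun z => by positivity)]
      calc ∫⁻ z, ENNReal.ofReal (2 + (t * U z) ^ 2) ∂(ν.prod ν)
          ≤ ∫⁻ z, (ENNReal.ofReal (Real.exp (t * U z))
            + ENNReal.ofReal (Real.exp (-t * U z))) ∂(ν.prod ν) := by
            refine lintegral_mono fun z => ?_
            rw [← ENNReal.ofReal_add (Real.exp_nonneg _) (Real.exp_nonneg _), neg_mul]
            exact ENNReal.ofReal_le_ofReal (two_add_sq_le_exp_add_exp_neg _)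
        _ ≤ ENNReal.ofReal (Real.exp (c * t ^ 2)) + ENNReal.ofReal (Real.exp (c * t ^ 2)) := by
            rw [lintegral_add_left (by fun_prop)]
            refine add_le_add (hexp t) ((hexp (-t)).trans_eq (by rw [neg_sq]))
        _ = ENNReal.ofReal (2 * Real.exp (c * t ^ 2)) := by
            rw [← ENNReal.ofReal_add (Real.exp_nonneg _) (Real.exp_nonneg _), two_mul]
    rw [ENNReal.ofReal_le_ofReal_iff (by positivity)] at h1
    simp_rw [mul_pow] at h1
    rw [integral_add (integrable_const _) (hU2.integrable_sq.const_mul _), integral_const_mul,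
      hUv] at h1
    simp only [integral_const, probReal_univ, smul_eq_mul, one_mul] at h1
    linarith
  refine ge_of_tendsto (tendsto_exp_mul_sub_one_div c) ?_
  filter_upwards [self_mem_nhdsWithin] with s hs
  have hs' : 0 < s := hs
  have := hineq (Real.sqrt s)
  rw [Real.sq_sqrt hs'.le] at this
  rw [le_div_iff₀ hs']
  linarith

theorem variance_inner_le_of_midpoint {D : ℕ} {q : EuclideanSpace ℝ (Fin D) → ℝ}
    (hq : Measurable q) (hq0 : ∀ x, 0 ≤ q x)
    (hq1 : IsProbabilityMeasure (volume.withDensity fun x => ENNReal.ofReal (q x)))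
    {κ : ℝ} (hκ : 0 < κ)
    (hmid : ∀ x y, q x * q y ≤ q ((2⁻¹ : ℝ) • (x + y)) ^ 2 * Real.exp (-(κ / 4 * ‖x - y‖ ^ 2)))
    (v : EuclideanSpace ℝ (Fin D))
    (hv : MemLp (fun x => ⟪v, x⟫) 2 (volume.withDensity fun x => ENNReal.ofReal (q x))) :
    Var[fun x => ⟪v, x⟫; volume.withDensity fun x => ENNReal.ofReal (q x)] ≤ ‖v‖ ^ 2 / κ := by
  refine variance_le_of_lintegral_exp_mul_le (by fun_prop) hv fun t => ?_
  refine (lintegral_exp_mul_lintegral_exp_neg_le hq hq0 hq1 hκ hmid v t).trans_eq ?_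
  congr 2
  ring

/-! ### Variance of linear functionals under log-smoothness -/

/-- The Hammersley–Chapman–Robbins bound for translates: the likelihood ratio
`r x = q (x + t v) / q x` has covariance `-t ‖v‖²` with `⟪v, ·⟫` under `q`, and log-smoothness
bounds its second moment, as `r² q ≤ exp (L t² ‖v‖²) q (· + 2 t v)`. -/
theorem two_mul_norm_sq_div_le_variance_inner_add {D : ℕ} {q : EuclideanSpace ℝ (Fin D) → ℝ}
    (hq : Measurable q) (hq0 : ∀ x, 0 < q x)
    (hq1 : IsProbabilityMeasure (volume.withDensity fun x => ENNReal.ofReal (q x)))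
    {L : ℝ} (hL : 0 < L)
    (hsmooth : ∀ x h, q x ^ 2 ≤ q (x + h) * q (x - h) * Real.exp (L * ‖h‖ ^ 2))
    (v : EuclideanSpace ℝ (Fin D))
    (hv : MemLp (fun x => ⟪v, x⟫) 2 (volume.withDensity fun x => ENNReal.ofReal (q x)))
    {t : ℝ} (ht : 0 < t) :
    2 * ‖v‖ ^ 2 / L ≤ Var[fun x => ⟪v, x⟫; volume.withDensity fun x => ENNReal.ofReal (q x)]
      + (Real.exp (L * ‖v‖ ^ 2 * t ^ 2) - 1) / t ^ 2 / L ^ 2 := by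
  set ν := volume.withDensity fun x => ENNReal.ofReal (q x) with hν
  have hqm : Measurable fun x => ENNReal.ofReal (q x) := hq.ennreal_ofReal
  have hqL : ∫⁻ x, ENNReal.ofReal (q x) = 1 := by
    rw [← hq1.measure_univ, withDensity_apply _ MeasurableSet.univ, setLIntegral_univ]
  have hqI : Integrable q := by
    refine ⟨hq.aestronglyMeasurable, ?_⟩
    rw [hasFiniteIntegral_iff_ofReal (Filter.Eventually.of_forall fun x => (hq0 x).le), hqL]
    simp
  have hqi : ∫ x, q x = 1 := by
    rw [integral_eq_lintegral_of_nonneg_ae (Filter.Eventually.of_forall fun x => (hq0 x).le)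
      hq.aestronglyMeasurable, hqL]
    simp
  have hint : ∀ g : EuclideanSpace ℝ (Fin D) → ℝ, ∫ x, g x ∂ν = ∫ x, q x * g x := by
    intro g
    rw [hν, integral_withDensity_eq_integral_toReal_smul hqm
      (Filter.Eventually.of_forall fun x => ENNReal.ofReal_lt_top)]
    refine integral_congr_ae (Filter.Eventually.of_forall fun x => ?_)
    simp [ENNReal.toReal_ofReal (hq0 x).le]
  have hWI : Integrable (fun x => q x * ⟪v, x⟫) := by
    have := (integrable_withDensity_iff_integrable_smul₀' hqm.aemeasurable
      (Filter.Eventually.of_forall fun x => ENNReal.ofReal_lt_top)).1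
      (hv.integrable (by norm_num))
    simpa [ENNReal.toReal_ofReal (hq0 _).le] using this
  set r : EuclideanSpace ℝ (Fin D) → ℝ := fun x => q (x + t • v) / q x with hr
  have hrm : Measurable r := (hq.comp (measurable_id.add_const _)).div hq
  -- second moment of the likelihood ratio
  have hr2L : ∫⁻ x, ENNReal.ofReal (r x ^ 2) ∂ν
      ≤ ENNReal.ofReal (Real.exp (L * ‖v‖ ^ 2 * t ^ 2)) := by
    rw [hν, lintegral_withDensity_eq_lintegral_mul _ hqm (by fun_prop)]
    calc _ ≤ ∫⁻ x, ENNReal.ofReal (Real.exp (L * ‖v‖ ^ 2 * t ^ 2)) *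
          ENNReal.ofReal (q (x + (2 * t) • v)) := by
          refine lintegral_mono fun x => ?_
          simp only [Pi.mul_apply]
          rw [← ENNReal.ofReal_mul (hq0 x).le, ← ENNReal.ofReal_mul (Real.exp_nonneg _)]
          refine ENNReal.ofReal_le_ofReal ?_
          have h1 := hsmooth (x + t • v) (t • v)
          rw [add_sub_cancel_right, add_assoc, ← add_smul, ← two_mul, norm_smul, mul_pow,
            Real.norm_eq_abs, sq_abs] at h1
          have h2 : q x * r x ^ 2 = q (x + t • v) ^ 2 / q x := by
            have := (hq0 x).ne'
            simp only [hr]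
            field_simp
          rw [h2, div_le_iff₀ (hq0 x)]
          refine h1.trans_eq ?_
          rw [show L * (t ^ 2 * ‖v‖ ^ 2) = L * ‖v‖ ^ 2 * t ^ 2 by ring]
          ring
      _ = _ := by
          rw [lintegral_const_mul' _ _ ENNReal.ofReal_ne_top,
            lintegral_add_right_eq_self (fun x => ENNReal.ofReal (q x)), hqL, mul_one]
  have hr2I : Integrable (fun x => r x ^ 2) ν := by
    refine ⟨(hrm.pow_const 2).aestronglyMeasurable, ?_⟩
    rw [hasFiniteIntegral_iff_ofReal (Filter.Eventually.of_forall fun x => sq_nonneg _)]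
    exact hr2L.trans_lt ENNReal.ofReal_lt_top
  have hrLp : MemLp r 2 ν := (memLp_two_iff_integrable_sq hrm.aestronglyMeasurable).2 hr2I
  have hr2 : ∫ x, r x ^ 2 ∂ν ≤ Real.exp (L * ‖v‖ ^ 2 * t ^ 2) := by
    rw [integral_eq_lintegral_of_nonneg_ae (Filter.Eventually.of_forall fun x => sq_nonneg _)
      (hrm.pow_const 2).aestronglyMeasurable]
    exact ENNReal.toReal_le_of_le_ofReal (Real.exp_nonneg _) hr2L
  have hqr : ∀ x, q x * r x = q (x + t • v) := fun x => mul_div_cancel₀ _ (hq0 x).ne'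
  have hr1 : ∫ x, r x ∂ν = 1 := by
    rw [hint]
    simp_rw [hqr]
    rw [integral_add_right_eq_self q, hqi]
  have hWr : ∫ x, ⟪v, x⟫ * r x ∂ν = ∫ x, ⟪v, x⟫ ∂ν - t * ‖v‖ ^ 2 := by
    rw [hint, hint]
    have : ∀ x, q x * (⟪v, x⟫ * r x)
        = (fun z => q z * ⟪v, z⟫ - t * ‖v‖ ^ 2 * q z) (x + t • v) := by
      intro x
      simp only [inner_add_right, inner_smul_right, real_inner_self_eq_norm_sq]
      rw [← hqr]
      ring
    simp_rw [this]
    rw [integral_add_right_eq_self (fun z => q z * ⟪v, z⟫ - t * ‖v‖ ^ 2 * q z),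
      integral_sub hWI (hqI.const_mul _), integral_const_mul, hqi, mul_one]
  have hcov : cov[fun x => ⟪v, x⟫, r; ν] = -(t * ‖v‖ ^ 2) := by
    rw [covariance_eq_sub hv hrLp, hr1]
    simp only [Pi.mul_apply]
    rw [hWr]
    ring
  have hvar : Var[r; ν] ≤ Real.exp (L * ‖v‖ ^ 2 * t ^ 2) - 1 := by
    rw [variance_eq_sub hrLp, hr1]
    simp only [Pi.pow_apply]
    linarith
  -- `(L t)⁻¹` is the optimal multiplier to first order as `t → 0`
  have h0 := variance_nonneg ((fun x => ⟪v, x⟫) + (L * t)⁻¹ • r) ν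
  rw [variance_add hv (hrLp.const_smul _), covariance_smul_right, hcov, variance_smul] at h0
  have h1 : (L * t)⁻¹ ^ 2 * Var[r; ν]
      ≤ (Real.exp (L * ‖v‖ ^ 2 * t ^ 2) - 1) / t ^ 2 / L ^ 2 := by
    calc _ ≤ (L * t)⁻¹ ^ 2 * (Real.exp (L * ‖v‖ ^ 2 * t ^ 2) - 1) := by gcongr
      _ = _ := by field_simp
  have h2 : 2 * ((L * t)⁻¹ * -(t * ‖v‖ ^ 2)) = -(2 * ‖v‖ ^ 2 / L) := by field_simp
  linarith

theorem norm_sq_div_le_variance_inner {D : ℕ} {q : EuclideanSpace ℝ (Fin D) → ℝ}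
    (hq : Measurable q) (hq0 : ∀ x, 0 < q x)
    (hq1 : IsProbabilityMeasure (volume.withDensity fun x => ENNReal.ofReal (q x)))
    {L : ℝ} (hL : 0 < L)
    (hsmooth : ∀ x h, q x ^ 2 ≤ q (x + h) * q (x - h) * Real.exp (L * ‖h‖ ^ 2))
    (v : EuclideanSpace ℝ (Fin D))
    (hv : MemLp (fun x => ⟪v, x⟫) 2 (volume.withDensity fun x => ENNReal.ofReal (q x))) :
    ‖v‖ ^ 2 / L ≤ Var[fun x => ⟪v, x⟫; volume.withDensity fun x => ENNReal.ofReal (q x)] := by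
  have hlim := ((tendsto_exp_mul_sub_one_div (L * ‖v‖ ^ 2)).div_const (L ^ 2)).const_add
    Var[fun x => ⟪v, x⟫; volume.withDensity fun x => ENNReal.ofReal (q x)]
  have hle : 2 * ‖v‖ ^ 2 / L ≤
      Var[fun x => ⟪v, x⟫; volume.withDensity fun x => ENNReal.ofReal (q x)]
        + L * ‖v‖ ^ 2 / L ^ 2 := by
    refine ge_of_tendsto hlim ?_
    filter_upwards [self_mem_nhdsWithin] with s hs
    have := two_mul_norm_sq_div_le_variance_inner_add hq hq0 hq1 hL hsmooth v hv
      (Real.sqrt_pos.2 hs)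
    rwa [Real.sq_sqrt (le_of_lt hs)] at this
  have : L * ‖v‖ ^ 2 / L ^ 2 = ‖v‖ ^ 2 / L := by field_simp
  rw [this, mul_div_assoc] at hle
  linarith

/-- A function with Lipschitz gradient has second differences bounded below: along the segment,
`s ↦ φ (x + s h) + φ (x - s h) + M s² ‖h‖²` has nonnegative derivative. -/
theorem two_mul_le_add_add_of_lipschitzWith_gradient {E : Type*} [NormedAddCommGroup E]
    [InnerProductSpace ℝ E] [CompleteSpace E] {φ : E → ℝ} (hφ : Differentiable ℝ φ) {M : ℝ≥0}
    (hM : LipschitzWith M (gradient φ)) (x h : E) :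
    2 * φ x ≤ φ (x + h) + φ (x - h) + M * ‖h‖ ^ 2 := by
  set G : ℝ → ℝ := fun s => φ (x + s • h) + φ (x - s • h) + M * ‖h‖ ^ 2 * s ^ 2 with hG
  have hd : ∀ s, HasDerivAt G (⟪gradient φ (x + s • h), h⟫ - ⟪gradient φ (x - s • h), h⟫
      + M * ‖h‖ ^ 2 * (2 * s)) s := by
    intro s
    have h1 : HasDerivAt (fun s : ℝ => x + s • h) h s := by
      simpa using ((hasDerivAt_id s).smul_const h).const_add x
    have h2 : HasDerivAt (fun s : ℝ => x - s • h) (-h) s := by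
      simpa using ((hasDerivAt_id s).smul_const h).const_sub x
    have h3 := ((hφ _).hasGradientAt.hasFDerivAt.comp_hasDerivAt s h1)
    have h4 := ((hφ _).hasGradientAt.hasFDerivAt.comp_hasDerivAt s h2)
    have h5 := ((hasDerivAt_pow 2 s).const_mul ((M : ℝ) * ‖h‖ ^ 2))
    refine ((h3.add h4).add h5).congr_deriv ?_
    simp [sub_eq_add_neg]
  have hmono : MonotoneOn G (Set.Icc 0 1) := by
    refine monotoneOn_of_deriv_nonneg (convex_Icc 0 1)
      (fun s _ => (hd s).continuousAt.continuousWithinAt)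
      (fun s _ => (hd s).differentiableAt.differentiableWithinAt) fun s hs => ?_
    rw [interior_Icc] at hs
    rw [(hd s).deriv, ← inner_sub_left]
    have h1 : ‖gradient φ (x + s • h) - gradient φ (x - s • h)‖ ≤ M * (2 * s * ‖h‖) := by
      refine (hM.norm_sub_le _ _).trans_eq ?_
      rw [show x + s • h - (x - s • h) = (2 * s) • h by rw [two_mul, add_smul]; abel, norm_smul,
        Real.norm_of_nonneg (by linarith [hs.1])]
    have h2 := abs_le.1 (abs_real_inner_le_norm
      (gradient φ (x + s • h) - gradient φ (x - s • h)) h)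
    have h3 := mul_le_mul_of_nonneg_right h1 (norm_nonneg h)
    nlinarith [h2.1]
  have := hmono (Set.left_mem_Icc.2 zero_le_one) (Set.right_mem_Icc.2 zero_le_one) zero_le_one
  simp only [hG, zero_smul, one_smul, add_zero, sub_zero] at this
  linarith

/-! ### Bayes' formula for Gaussian noise -/

theorem integral_exp_neg_norm_sq_div_pos (E : Type*) [NormedAddCommGroup E]
    [InnerProductSpace ℝ E] [FiniteDimensional ℝ E] [MeasurableSpace E] [BorelSpace E]
    {σ : ℝ} (hσ : 0 < σ) :
    0 < ∫ z : E, Real.exp (-‖z‖ ^ 2 / (2 * σ ^ 2)) := by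
  have hb : 0 < 1 / (2 * σ ^ 2) := by positivity
  have h := GaussianFourier.integral_rexp_neg_mul_sq_norm (V := E) hb
  have h' : ∀ z : E, -‖z‖ ^ 2 / (2 * σ ^ 2) = -(1 / (2 * σ ^ 2)) * ‖z‖ ^ 2 := fun z => by ring
  simp_rw [h']
  rw [h]
  positivity

/-- Both sides have the same characteristic function. -/
theorem map_smul_stdGaussian_eq_withDensity {E : Type*} [NormedAddCommGroup E]
    [InnerProductSpace ℝ E] [FiniteDimensional ℝ E] [MeasurableSpace E] [BorelSpace E]
    {σ : ℝ} (hσ : 0 < σ) :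
    (stdGaussian E).map (fun z => σ • z) = volume.withDensity fun x => ENNReal.ofReal
      ((∫ z : E, Real.exp (-‖z‖ ^ 2 / (2 * σ ^ 2)))⁻¹ * Real.exp (-‖x‖ ^ 2 / (2 * σ ^ 2))) := by
  set N := ∫ z : E, Real.exp (-‖z‖ ^ 2 / (2 * σ ^ 2)) with hN
  have hN0 : 0 < N := integral_exp_neg_norm_sq_div_pos E hσ
  have hI : Integrable fun x : E => N⁻¹ * Real.exp (-‖x‖ ^ 2 / (2 * σ ^ 2)) :=
    (Integrable.of_integral_ne_zero hN0.ne').const_mul _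
  have hfin := isFiniteMeasure_withDensity_ofReal hI.2
  have hprob : IsProbabilityMeasure ((stdGaussian E).map (fun z => σ • z)) :=
    Measure.isProbabilityMeasure_map (by fun_prop)
  have hb : 0 < ((1 / (2 * σ ^ 2) : ℝ) : ℂ).re := by
    rw [Complex.ofReal_re]; positivity
  have hNc : (N : ℂ) = (Real.pi / ((1 / (2 * σ ^ 2) : ℝ) : ℂ)) ^ (Module.finrank ℝ E / 2 : ℂ) := by
    rw [← GaussianFourier.integral_cexp_neg_mul_sq_norm hb, hN, ← integral_complex_ofReal]
    refine integral_congr_ae (Filter.Eventually.of_forall fun x => ?_)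
    push_cast
    congr 1
    ring
  refine Measure.ext_of_charFun ?_
  ext t
  rw [charFun_map_smul, charFun_stdGaussian, charFun_apply,
    integral_withDensity_eq_integral_toReal_smul (by fun_prop)
      (Filter.Eventually.of_forall fun x => ENNReal.ofReal_lt_top)]
  have h1 : ∀ x : E, (ENNReal.ofReal (N⁻¹ * Real.exp (-‖x‖ ^ 2 / (2 * σ ^ 2)))).toReal •
      Complex.exp (⟪x, t⟫ * Complex.I) = (N : ℂ)⁻¹ *
        Complex.exp (-((1 / (2 * σ ^ 2) : ℝ) : ℂ) * ‖x‖ ^ 2 + Complex.I * ⟪t, x⟫) := by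
    intro x
    rw [ENNReal.toReal_ofReal (by positivity), Complex.real_smul, real_inner_comm,
      Complex.exp_add]
    push_cast
    rw [mul_assoc, mul_comm (Complex.I)]
    congr 3
    ring
  simp_rw [h1]
  rw [integral_const_mul, GaussianFourier.integral_cexp_neg_mul_sq_norm_add hb, ← hNc,
    ← mul_assoc, inv_mul_cancel₀ (by exact_mod_cast hN0.ne'), one_mul, norm_smul, Complex.I_sq,
    Real.norm_of_nonneg hσ.le]
  congr 1
  have : (σ : ℂ) ≠ 0 := by exact_mod_cast hσ.ne'
  push_cast
  field_simp
  ring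

/-- Bayes' formula: if a joint law has density `Z y * d (y, x)` with respect to `α ⊗ P`, with each
`d (y, ·)` a probability density with respect to `P`, then the kernel with densities `d (y, ·)`
disintegrates it. -/
theorem withDensity_eq_fst_compProd {α β : Type*} [MeasurableSpace α] [MeasurableSpace β]
    {μ : Measure α} [SFinite μ] {P : Measure β} [SFinite P] {Z : α → ℝ≥0∞} (hZ : Measurable Z)
    {d : α × β → ℝ≥0∞} (hd : Measurable d) {η : Kernel α β} [IsMarkovKernel η]
    (hη : ∀ y, η y = P.withDensity fun x => d (y, x))
    [SFinite ((μ.prod P).withDensity fun z => Z z.1 * d z).fst] :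
    (μ.prod P).withDensity (fun z => Z z.1 * d z)
      = ((μ.prod P).withDensity fun z => Z z.1 * d z).fst ⊗ₘ η := by
  have hZd : Measurable fun z : α × β => Z z.1 * d z := (hZ.comp measurable_fst).mul hd
  have hJ : ∀ F : α × β → ℝ≥0∞, Measurable F →
      ∫⁻ z, F z ∂(μ.prod P).withDensity (fun z => Z z.1 * d z)
        = ∫⁻ y, Z y * ∫⁻ x, F (y, x) ∂η y ∂μ := by
    intro F hF
    rw [lintegral_withDensity_eq_lintegral_mul _ hZd hF, lintegral_prod _ (hZd.mul hF).aemeasurable]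
    refine lintegral_congr fun y => ?_
    rw [hη, lintegral_withDensity_eq_lintegral_mul _ (by fun_prop) (by fun_prop),
      ← lintegral_const_mul _ (by fun_prop)]
    refine lintegral_congr fun x => ?_
    simp [mul_assoc]
  refine Measure.ext_of_lintegral _ fun F hF => ?_
  rw [Measure.lintegral_compProd hF, Measure.fst, lintegral_map hF.lintegral_kernel_prod_right'
    measurable_fst, hJ F hF]
  refine ((hJ _ (hF.lintegral_kernel_prod_right'.comp measurable_fst)).trans ?_).symm
  simp

/-- If the noise has density `ρ`, the joint law of `(X + noise, X)` has density
`(y, x) ↦ ρ (y - x)` with respect to `volume ⊗ P`. -/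
theorem map_add_prod_withDensity {E : Type*} [AddCommGroup E] [MeasurableSpace E]
    [MeasurableAdd₂ E] [MeasurableNeg E] {μ : Measure E} [SFinite μ] [μ.IsAddLeftInvariant]
    {P : Measure E} [SFinite P]
    {ρ : E → ℝ≥0∞} (hρ : Measurable ρ) [SFinite (μ.withDensity ρ)] :
    (P.prod (μ.withDensity ρ)).map (fun z => (z.1 + z.2, z.1))
      = (μ.prod P).withDensity fun z => ρ (z.1 - z.2) := by
  have hm : Measurable fun z : E × E => (z.1 + z.2, z.1) := by fun_prop
  have hρ' : Measurable fun z : E × E => ρ (z.1 - z.2) := by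
    simp_rw [sub_eq_add_neg]
    exact hρ.comp (by fun_prop)
  refine Measure.ext_of_lintegral _ fun F hF => ?_
  rw [lintegral_map hF hm, lintegral_prod _ (by fun_prop),
    lintegral_withDensity_eq_lintegral_mul _ hρ' hF,
    lintegral_prod_symm _ (hρ'.mul hF).aemeasurable]
  refine lintegral_congr fun x => ?_
  simp only [Pi.mul_apply]
  rw [lintegral_withDensity_eq_lintegral_mul _ hρ (by fun_prop),
    ← lintegral_add_left_eq_self (fun y => ρ (y - x) * F (y, x)) x]
  refine lintegral_congr fun z => ?_
  simp

theorem integrable_exp_neg_norm_sub_sq_div {E : Type*} [NormedAddCommGroup E] [MeasurableSpace E]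
    [BorelSpace E] (P : Measure E) [IsFiniteMeasure P] (σ : ℝ) (y : E) :
    Integrable (fun x => Real.exp (-‖y - x‖ ^ 2 / (2 * σ ^ 2))) P := by
  refine Integrable.of_bound (C := 1) ?_ (Filter.Eventually.of_forall fun x => ?_)
  · have : Continuous fun x => Real.exp (-‖y - x‖ ^ 2 / (2 * σ ^ 2)) := by fun_prop
    exact this.measurable.aestronglyMeasurable
  · rw [Real.norm_of_nonneg (Real.exp_nonneg _), Real.exp_le_one_iff]
    exact div_nonpos_of_nonpos_of_nonneg (by simp) (by positivity)

theorem isProbabilityMeasure_gaussianPosterior {D : ℕ} (P : Measure (EuclideanSpace ℝ (Fin D)))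
    [IsProbabilityMeasure P] (σ : ℝ) (y : EuclideanSpace ℝ (Fin D)) :
    IsProbabilityMeasure (gaussianPosterior P σ y) :=
  isProbabilityMeasure_tilted (integrable_exp_neg_norm_sub_sq_div P σ y)

theorem condDistrib_ae_eq_gaussianPosterior {D : ℕ} {Ω : Type*} [MeasurableSpace Ω]
    {μ : Measure Ω} [IsProbabilityMeasure μ] {P : Measure (EuclideanSpace ℝ (Fin D))}
    [IsProbabilityMeasure P] {X ξ : Ω → EuclideanSpace ℝ (Fin D)}
    (hXξ : HasLaw (fun ω => (X ω, ξ ω)) (P.prod (stdGaussian (EuclideanSpace ℝ (Fin D)))) μ)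
    {σ : ℝ} (hσ : 0 < σ) :
    ∀ᵐ y ∂(μ.map (fun ω => X ω + σ • ξ ω)),
      condDistrib X (fun ω => X ω + σ • ξ ω) μ y = gaussianPosterior P σ y := by
  set Z : EuclideanSpace ℝ (Fin D) → ℝ := fun y =>
    ∫ x, Real.exp (-‖y - x‖ ^ 2 / (2 * σ ^ 2)) ∂P with hZ
  set N := ∫ z : EuclideanSpace ℝ (Fin D), Real.exp (-‖z‖ ^ 2 / (2 * σ ^ 2)) with hN
  have hN0 : 0 < N := integral_exp_neg_norm_sq_div_pos _ hσ
  have hZ0 : ∀ y, 0 < Z y := fun y =>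
    integral_exp_pos (integrable_exp_neg_norm_sub_sq_div P σ y)
  have hexp : Measurable fun z : EuclideanSpace ℝ (Fin D) × EuclideanSpace ℝ (Fin D) =>
      Real.exp (-‖z.1 - z.2‖ ^ 2 / (2 * σ ^ 2)) := by
    have : Continuous fun z : EuclideanSpace ℝ (Fin D) × EuclideanSpace ℝ (Fin D) =>
        Real.exp (-‖z.1 - z.2‖ ^ 2 / (2 * σ ^ 2)) := by fun_prop
    exact this.measurable
  have hZm : Measurable Z := hexp.stronglyMeasurable.integral_prod_right'.measurable
  set d : EuclideanSpace ℝ (Fin D) × EuclideanSpace ℝ (Fin D) → ℝ≥0∞ := fun z =>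
    ENNReal.ofReal (Real.exp (-‖z.1 - z.2‖ ^ 2 / (2 * σ ^ 2)) / Z z.1) with hd
  have hdm : Measurable d := (hexp.div (hZm.comp measurable_fst)).ennreal_ofReal
  set η : Kernel (EuclideanSpace ℝ (Fin D)) (EuclideanSpace ℝ (Fin D)) :=
    Kernel.withDensity (Kernel.const _ P) (fun y x => d (y, x)) with hη
  have hηy : ∀ y, η y = P.withDensity fun x => d (y, x) := fun y => by
    rw [hη, Kernel.withDensity_apply _ (by exact hdm), Kernel.const_apply]
  have hηpost : ∀ y, η y = gaussianPosterior P σ y := hηy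
  have : IsMarkovKernel η :=
    ⟨fun y => by rw [hηpost]; exact isProbabilityMeasure_gaussianPosterior P σ y⟩
  have hXm : AEMeasurable X μ := measurable_fst.comp_aemeasurable hXξ.aemeasurable
  have hJm : Measurable fun z : EuclideanSpace ℝ (Fin D) × EuclideanSpace ℝ (Fin D) =>
      (z.1 + σ • z.2, z.1) := by fun_prop
  -- the joint law of `(X + σ ξ, X)`
  have hJ : μ.map (fun ω => (X ω + σ • ξ ω, X ω))
      = ((volume : Measure (EuclideanSpace ℝ (Fin D))).prod P).withDensity
        fun z => ENNReal.ofReal (N⁻¹ * Z z.1) * d z := by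
    have h1 : μ.map (fun ω => (X ω + σ • ξ ω, X ω))
        = (P.prod ((stdGaussian (EuclideanSpace ℝ (Fin D))).map fun z => σ • z)).map
          (fun z => (z.1 + z.2, z.1)) := by
      have h2 := Measure.map_prod_map P (stdGaussian (EuclideanSpace ℝ (Fin D))) measurable_id
        (g := fun z => σ • z)
        (by fun_prop)
      rw [Measure.map_id] at h2
      rw [h2, Measure.map_map (by fun_prop) (by fun_prop), ← hXξ.map_eq,
        AEMeasurable.map_map_of_aemeasurable (by fun_prop) hXξ.aemeasurable]
      rfl
    have hprob : IsProbabilityMeasure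
        ((stdGaussian (EuclideanSpace ℝ (Fin D))).map (fun z => σ • z)) :=
      Measure.isProbabilityMeasure_map (by fun_prop)
    rw [map_smul_stdGaussian_eq_withDensity hσ, ← hN] at h1 hprob
    rw [h1, map_add_prod_withDensity (by fun_prop)]
    congr 1
    ext z
    rw [← ENNReal.ofReal_mul (by have := hZ0 z.1; positivity)]
    congr 1
    have := (hZ0 z.1).ne'
    field_simp
  have hfst : μ.map (fun ω => X ω + σ • ξ ω)
      = (μ.map (fun ω => (X ω + σ • ξ ω, X ω))).fst := by
    exact (AEMeasurable.map_map_of_aemeasurable measurable_fst.aemeasurable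
      (hJm.comp_aemeasurable hXξ.aemeasurable)).symm
  have hprobJ : SFinite (μ.map (fun ω => (X ω + σ • ξ ω, X ω))).fst := inferInstance
  have hcomp : μ.map (fun ω => (X ω + σ • ξ ω, X ω))
      = μ.map (fun ω => X ω + σ • ξ ω) ⊗ₘ η := by
    rw [hfst]
    rw [hJ] at hprobJ ⊢
    exact withDensity_eq_fst_compProd (Z := fun y => ENNReal.ofReal (N⁻¹ * Z y)) (by fun_prop) hdm
      hηy
  filter_upwards [condDistrib_ae_eq_of_measure_eq_compProd _ hXm hcomp] with y hy
  rw [hy, hηpost]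

/-! ### The Gaussian posterior -/

/-- The Lebesgue density of `gaussianPosterior P σ y` when `P` has density `p`. -/
noncomputable def gaussianPosteriorDensity {D : ℕ} (P : Measure (EuclideanSpace ℝ (Fin D)))
    (p : EuclideanSpace ℝ (Fin D) → ℝ) (σ : ℝ) (y x : EuclideanSpace ℝ (Fin D)) : ℝ :=
  p x * (Real.exp (-‖y - x‖ ^ 2 / (2 * σ ^ 2)) /
    ∫ z, Real.exp (-‖y - z‖ ^ 2 / (2 * σ ^ 2)) ∂P)

section

variable {D : ℕ} {P : Measure (EuclideanSpace ℝ (Fin D))} {p : EuclideanSpace ℝ (Fin D) → ℝ}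
  {σ : ℝ}

theorem measurable_gaussianPosteriorDensity (hp : Measurable p) (y : EuclideanSpace ℝ (Fin D)) :
    Measurable (gaussianPosteriorDensity P p σ y) := by
  unfold gaussianPosteriorDensity
  fun_prop

/-- Nonnegativity of `p` is needed only because `ENNReal.ofReal` truncates. -/
theorem gaussianPosterior_eq_withDensity (hp : Measurable p) (hp0 : ∀ x, 0 ≤ p x)
    (hP : P = volume.withDensity fun x => ENNReal.ofReal (p x)) (y : EuclideanSpace ℝ (Fin D)) :
    gaussianPosterior P σ y
      = volume.withDensity fun x => ENNReal.ofReal (gaussianPosteriorDensity P p σ y x) := by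
  unfold gaussianPosterior gaussianPosteriorDensity Measure.tilted
  generalize ∫ z, Real.exp (-‖y - z‖ ^ 2 / (2 * σ ^ 2)) ∂P = Z
  rw [hP, ← withDensity_mul _ (by fun_prop) (by fun_prop)]
  congr 1
  ext x
  simp only [Pi.mul_apply]
  rw [ENNReal.ofReal_mul (hp0 x)]

theorem exp_two_mul_eq_sq (u : ℝ) : Real.exp (2 * u) = Real.exp u ^ 2 := by
  rw [two_mul, Real.exp_add, sq]

/-- The Gaussian factor adds `1 / σ ^ 2` to the constant of strong log-concavity. -/
theorem gaussianPosteriorDensity_mul_le [IsProbabilityMeasure P] {m : ℝ}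
    (hp : IsStronglyLogConcave m p) (y x x' : EuclideanSpace ℝ (Fin D)) :
    gaussianPosteriorDensity P p σ y x * gaussianPosteriorDensity P p σ y x'
      ≤ gaussianPosteriorDensity P p σ y ((2⁻¹ : ℝ) • (x + x')) ^ 2 *
        Real.exp (-((m + 1 / σ ^ 2) / 4 * ‖x - x'‖ ^ 2)) := by
  unfold gaussianPosteriorDensity
  have hZ := integral_exp_pos (integrable_exp_neg_norm_sub_sq_div P σ y)
  generalize ∫ z, Real.exp (-‖y - z‖ ^ 2 / (2 * σ ^ 2)) ∂P = Z at hZ ⊢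
  have hpp : p x * p x' ≤ p ((2⁻¹ : ℝ) • (x + x')) ^ 2 * Real.exp (-(m / 4 * ‖x - x'‖ ^ 2)) := by
    -- where `p` vanishes, `Real.log` says nothing and the inequality is trivial
    rcases (hp.1 x).eq_or_lt with hx | hx
    · rw [← hx, zero_mul]; positivity
    rcases (hp.1 x').eq_or_lt with hx' | hx'
    · rw [← hx', mul_zero]; positivity
    have h := hp.2.2 hx hx' (by norm_num : (0 : ℝ) ≤ 2⁻¹) (by norm_num : (0 : ℝ) ≤ 2⁻¹)
      (by norm_num)
    have hpos : 0 < p ((2⁻¹ : ℝ) • (x + x')) := by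
      rw [smul_add]
      exact hp.2.1 hx hx' (by norm_num : (0 : ℝ) ≤ 2⁻¹) (by norm_num : (0 : ℝ) ≤ 2⁻¹)
        (by norm_num)
    rw [← smul_add (2⁻¹ : ℝ) x x'] at h
    simp only [smul_eq_mul] at h
    rw [← Real.log_le_log_iff (by positivity) (by positivity), Real.log_mul hx.ne' hx'.ne',
      Real.log_mul (by positivity) (Real.exp_ne_zero _), Real.log_exp, Real.log_pow]
    push_cast
    linarith
  have hpar : -‖y - x‖ ^ 2 / (2 * σ ^ 2) + -‖y - x'‖ ^ 2 / (2 * σ ^ 2)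
      = 2 * (-‖y - (2⁻¹ : ℝ) • (x + x')‖ ^ 2 / (2 * σ ^ 2))
        + -(1 / σ ^ 2 / 4 * ‖x - x'‖ ^ 2) := by
    have h1 := parallelogram_law_with_norm ℝ (y - x) (y - x')
    have h2 : y - x + (y - x') = (2 : ℝ) • (y - (2⁻¹ : ℝ) • (x + x')) := by module
    rw [h2, sub_sub_sub_cancel_left, norm_smul, Real.norm_ofNat, norm_sub_rev x' x] at h1
    have h3 : ‖y - x‖ ^ 2 + ‖y - x'‖ ^ 2
        = 2 * ‖y - (2⁻¹ : ℝ) • (x + x')‖ ^ 2 + ‖x - x'‖ ^ 2 / 2 := by linarith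
    rw [← add_div, ← neg_add, h3]
    ring
  calc _ = p x * p x' * (Real.exp (-‖y - x‖ ^ 2 / (2 * σ ^ 2) + -‖y - x'‖ ^ 2 / (2 * σ ^ 2))
        / Z ^ 2) := by rw [Real.exp_add]; field_simp
    _ ≤ p ((2⁻¹ : ℝ) • (x + x')) ^ 2 * Real.exp (-(m / 4 * ‖x - x'‖ ^ 2)) *
        (Real.exp (-‖y - x‖ ^ 2 / (2 * σ ^ 2) + -‖y - x'‖ ^ 2 / (2 * σ ^ 2)) / Z ^ 2) :=
        mul_le_mul_of_nonneg_right hpp (by positivity)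
    _ = _ := by
        rw [hpar, Real.exp_add, exp_two_mul_eq_sq]
        rw [show -((m + 1 / σ ^ 2) / 4 * ‖x - x'‖ ^ 2)
          = -(m / 4 * ‖x - x'‖ ^ 2) + -(1 / σ ^ 2 / 4 * ‖x - x'‖ ^ 2) by ring, Real.exp_add]
        ring

/-- The Gaussian factor adds `1 / σ ^ 2` to the constant of log-smoothness. -/
theorem gaussianPosteriorDensity_sq_le [IsProbabilityMeasure P] {M : ℝ≥0}
    (hp : HasLipschitzScore M p) (y x h : EuclideanSpace ℝ (Fin D)) :
    gaussianPosteriorDensity P p σ y x ^ 2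
      ≤ gaussianPosteriorDensity P p σ y (x + h) * gaussianPosteriorDensity P p σ y (x - h) *
        Real.exp ((M + 1 / σ ^ 2) * ‖h‖ ^ 2) := by
  unfold gaussianPosteriorDensity
  have hZ := integral_exp_pos (integrable_exp_neg_norm_sub_sq_div P σ y)
  generalize ∫ z, Real.exp (-‖y - z‖ ^ 2 / (2 * σ ^ 2)) ∂P = Z at hZ ⊢
  obtain ⟨hp0, hpd, hpM⟩ := hp
  have hpp : p x ^ 2 ≤ p (x + h) * p (x - h) * Real.exp (M * ‖h‖ ^ 2) := by
    have h1 := two_mul_le_add_add_of_lipschitzWith_gradient hpd hpM x h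
    have := hp0 x
    have := hp0 (x + h)
    have := hp0 (x - h)
    rw [← Real.log_le_log_iff (by positivity) (by positivity),
      Real.log_mul (by positivity) (Real.exp_ne_zero _), Real.log_mul (by positivity)
      (by positivity), Real.log_exp, Real.log_pow]
    exact_mod_cast h1
  have hpar : 2 * (-‖y - x‖ ^ 2 / (2 * σ ^ 2))
      = -‖y - (x + h)‖ ^ 2 / (2 * σ ^ 2) + -‖y - (x - h)‖ ^ 2 / (2 * σ ^ 2)
        + 1 / σ ^ 2 * ‖h‖ ^ 2 := by
    have h1 := parallelogram_law_with_norm ℝ (y - x) h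
    have h2 : ‖y - (x + h)‖ ^ 2 + ‖y - (x - h)‖ ^ 2 = 2 * ‖y - x‖ ^ 2 + 2 * ‖h‖ ^ 2 := by
      rw [← sub_sub, sub_sub_eq_add_sub, ← sub_add_eq_add_sub]
      linarith
    rw [← add_div, ← neg_add, h2]
    ring
  calc _ = p x ^ 2 * (Real.exp (2 * (-‖y - x‖ ^ 2 / (2 * σ ^ 2))) / Z ^ 2) := by
        rw [exp_two_mul_eq_sq]; ring
    _ ≤ p (x + h) * p (x - h) * Real.exp (M * ‖h‖ ^ 2) *
        (Real.exp (2 * (-‖y - x‖ ^ 2 / (2 * σ ^ 2))) / Z ^ 2) :=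
        mul_le_mul_of_nonneg_right hpp (by positivity)
    _ = _ := by
        rw [hpar, Real.exp_add, Real.exp_add, add_mul, Real.exp_add]
        ring

/-- The Gaussian factor makes the second moment finite, whatever `P` is. -/
theorem memLp_id_gaussianPosterior [IsProbabilityMeasure P] (hσ : 0 < σ)
    (y : EuclideanSpace ℝ (Fin D)) : MemLp id 2 (gaussianPosterior P σ y) := by
  rw [memLp_two_iff_integrable_sq_norm (by fun_prop)]
  unfold gaussianPosterior
  rw [integrable_tilted_iff (integrable_exp_neg_norm_sub_sq_div P σ y)]
  refine Integrable.of_bound (C := 2 * ‖y‖ ^ 2 + 4 * σ ^ 2) ?_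
    (Filter.Eventually.of_forall fun x => ?_)
  · have : Continuous fun x : EuclideanSpace ℝ (Fin D) =>
        Real.exp (-‖y - x‖ ^ 2 / (2 * σ ^ 2)) • ‖id x‖ ^ 2 := by fun_prop
    exact this.measurable.aestronglyMeasurable
  · rw [smul_eq_mul, Real.norm_of_nonneg (by positivity), id, neg_div]
    set u := ‖y - x‖ ^ 2 / (2 * σ ^ 2) with hu
    have hu0 : 0 ≤ u := by positivity
    have hux : ‖y - x‖ ^ 2 = 2 * σ ^ 2 * u := by rw [hu]; field_simp
    have h1 : ‖x‖ ^ 2 ≤ 2 * ‖y‖ ^ 2 + 4 * σ ^ 2 * u := by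
      have h2 : ‖x‖ ≤ ‖y‖ + ‖y - x‖ := by
        calc ‖x‖ = ‖y - (y - x)‖ := by rw [sub_sub_cancel]
          _ ≤ _ := norm_sub_le _ _
      nlinarith [norm_nonneg x, norm_nonneg y, norm_nonneg (y - x), sq_nonneg (‖y‖ - ‖y - x‖)]
    -- `x ↦ ‖x‖² exp (-u)` is bounded since `exp (-u)` and `u exp (-u)` are at most `1`
    have h3 : Real.exp (-u) ≤ 1 := Real.exp_le_one_iff.2 (by linarith)
    have h4 : Real.exp (-u) * u ≤ 1 := by
      rw [Real.exp_neg, inv_mul_le_iff₀ (Real.exp_pos _)]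
      linarith [Real.add_one_le_exp u]
    calc Real.exp (-u) * ‖x‖ ^ 2 ≤ Real.exp (-u) * (2 * ‖y‖ ^ 2 + 4 * σ ^ 2 * u) := by gcongr
      _ = Real.exp (-u) * (2 * ‖y‖ ^ 2) + 4 * σ ^ 2 * (Real.exp (-u) * u) := by ring
      _ ≤ 1 * (2 * ‖y‖ ^ 2) + 4 * σ ^ 2 * 1 := by gcongr
      _ = _ := by ring

end

/-! ### Covariance matrices and the Loewner order -/

theorem memLp_inner_of_memLp_id {D : ℕ} {ν : Measure (EuclideanSpace ℝ (Fin D))}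
    (hν : MemLp id 2 ν) (v : EuclideanSpace ℝ (Fin D)) : MemLp (fun x => ⟪v, x⟫) 2 ν :=
  hν.const_inner v

theorem dotProduct_covMatrix_mulVec {D : ℕ} {ν : Measure (EuclideanSpace ℝ (Fin D))}
    [IsProbabilityMeasure ν] (hν : MemLp id 2 ν) (v : Fin D → ℝ) :
    v ⬝ᵥ (covMatrix ν).mulVec v = Var[fun x => ⟪WithLp.toLp 2 v, x⟫; ν] := by
  have hi : ∀ i, MemLp (fun x : EuclideanSpace ℝ (Fin D) => v i * x i) 2 ν := fun i => by
    have := memLp_inner_of_memLp_id hν (EuclideanSpace.single i 1)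
    simp only [EuclideanSpace.inner_single_left, map_one, one_mul] at this
    exact this.const_mul _
  have h : (fun x : EuclideanSpace ℝ (Fin D) => ⟪WithLp.toLp 2 v, x⟫)
      = fun x => ∑ i, v i * x i := by
    ext x
    simp [PiLp.inner_apply, mul_comm]
  rw [h, variance_fun_sum hi]
  simp only [dotProduct, Matrix.mulVec, covMatrix, Matrix.of_apply, Finset.mul_sum]
  refine Finset.sum_congr rfl fun i _ => Finset.sum_congr rfl fun j _ => ?_
  rw [covariance_const_mul_left, covariance_const_mul_right]
  ring

theorem isHermitian_covMatrix {D : ℕ} (ν : Measure (EuclideanSpace ℝ (Fin D))) :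
    (covMatrix ν).IsHermitian := by
  ext i j
  simp [covMatrix, covariance_comm]

theorem posSemidef_smul_one_sub_covMatrix {D : ℕ} {ν : Measure (EuclideanSpace ℝ (Fin D))}
    [IsProbabilityMeasure ν] (hν : MemLp id 2 ν) {c : ℝ}
    (h : ∀ v : EuclideanSpace ℝ (Fin D), Var[fun x => ⟪v, x⟫; ν] ≤ c * ‖v‖ ^ 2) :
    (c • (1 : Matrix (Fin D) (Fin D) ℝ) - covMatrix ν).PosSemidef := by
  refine Matrix.PosSemidef.of_dotProduct_mulVec_nonneg
    ((Matrix.isHermitian_one.smul (IsSelfAdjoint.all c)).sub (isHermitian_covMatrix ν)) fun v => ?_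
  have h1 := h (WithLp.toLp 2 v)
  rw [EuclideanSpace.real_norm_sq_eq] at h1
  rw [star_trivial, Matrix.sub_mulVec, dotProduct_sub, dotProduct_covMatrix_mulVec hν,
    Matrix.smul_mulVec, Matrix.one_mulVec, dotProduct_smul, smul_eq_mul, dotProduct]
  simp only [← sq]
  linarith

theorem posSemidef_covMatrix_sub_smul_one {D : ℕ} {ν : Measure (EuclideanSpace ℝ (Fin D))}
    [IsProbabilityMeasure ν] (hν : MemLp id 2 ν) {c : ℝ}
    (h : ∀ v : EuclideanSpace ℝ (Fin D), c * ‖v‖ ^ 2 ≤ Var[fun x => ⟪v, x⟫; ν]) :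
    (covMatrix ν - c • (1 : Matrix (Fin D) (Fin D) ℝ)).PosSemidef := by
  refine Matrix.PosSemidef.of_dotProduct_mulVec_nonneg
    ((isHermitian_covMatrix ν).sub (Matrix.isHermitian_one.smul (IsSelfAdjoint.all c))) fun v => ?_
  have h1 := h (WithLp.toLp 2 v)
  rw [EuclideanSpace.real_norm_sq_eq] at h1
  rw [star_trivial, Matrix.sub_mulVec, dotProduct_sub, dotProduct_covMatrix_mulVec hν,
    Matrix.smul_mulVec, Matrix.one_mulVec, dotProduct_smul, smul_eq_mul, dotProduct]
  simp only [← sq]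
  linarith

theorem mainTheorem5 {D : ℕ} {Ω : Type*} [MeasurableSpace Ω] (μ : Measure Ω)
    [IsProbabilityMeasure μ]
    (P : Measure (EuclideanSpace ℝ (Fin D))) [IsProbabilityMeasure P]
    (p : EuclideanSpace ℝ (Fin D) → ℝ) (hp_meas : Measurable p)
    (hP : P = volume.withDensity (fun x => ENNReal.ofReal (p x)))
    (X ξ : Ω → EuclideanSpace ℝ (Fin D))
    (hXξ : HasLaw (fun ω => (X ω, ξ ω))
      (P.prod (stdGaussian (EuclideanSpace ℝ (Fin D)))) μ)
    (m : ℝ) (hm : 0 < m) (hp : IsStronglyLogConcave m p)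
    (σ : ℝ) (hσ : 0 < σ) :
    -- `gaussianPosterior P σ` is a version of the conditional law of `X` given `X + σ ξ`
    (∀ᵐ y ∂(μ.map (fun ω => X ω + σ • ξ ω)),
      condDistrib X (fun ω => X ω + σ • ξ ω) μ y = gaussianPosterior P σ y) ∧
    (∀ y, IsProbabilityMeasure (gaussianPosterior P σ y) ∧
      MemLp id 2 (gaussianPosterior P σ y)) ∧
    -- upper bound on the conditional variance, for every `y`
    (∀ y, ((σ ^ 2 / (1 + m * σ ^ 2)) • (1 : Matrix (Fin D) (Fin D) ℝ)
      - covMatrix (gaussianPosterior P σ y)).PosSemidef) ∧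
    -- lower bound on the conditional variance, for every `y`
    (∀ M : ℝ≥0, 0 < M → HasLipschitzScore M p → ∀ y,
      (covMatrix (gaussianPosterior P σ y)
        - (σ ^ 2 / (1 + (M : ℝ) * σ ^ 2)) • (1 : Matrix (Fin D) (Fin D) ℝ)).PosSemidef) := by

  refine ⟨condDistrib_ae_eq_gaussianPosterior hXξ hσ,
    fun y => ⟨isProbabilityMeasure_gaussianPosterior P σ y, memLp_id_gaussianPosterior hσ y⟩,
    fun y => ?_, fun M hM hpM y => ?_⟩
  all_goals
    have hprob := isProbabilityMeasure_gaussianPosterior P σ y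
    have hLp := memLp_id_gaussianPosterior (P := P) hσ y
    have hdens := gaussianPosterior_eq_withDensity (σ := σ) hp_meas hp.1 hP y
    have hqm := measurable_gaussianPosteriorDensity (P := P) (σ := σ) hp_meas y
    have hZ := integral_exp_pos (integrable_exp_neg_norm_sub_sq_div P σ y)
  · refine posSemidef_smul_one_sub_covMatrix hLp fun v => ?_
    have hv := memLp_inner_of_memLp_id hLp v
    rw [hdens] at hprob hv ⊢
    refine (variance_inner_le_of_midpoint (κ := m + 1 / σ ^ 2) hqm
      (fun x => mul_nonneg (hp.1 x) (div_nonneg (Real.exp_nonneg _) hZ.le)) hprob (by positivity)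
      (gaussianPosteriorDensity_mul_le hp y) v hv).trans_eq ?_
    field_simp
    ring
  · refine posSemidef_covMatrix_sub_smul_one hLp fun v => ?_
    have hv := memLp_inner_of_memLp_id hLp v
    rw [hdens] at hprob hv ⊢
    refine Eq.trans_le ?_ (norm_sq_div_le_variance_inner (L := M + 1 / σ ^ 2) hqm
      (fun x => mul_pos (hpM.1 x) (div_pos (Real.exp_pos _) hZ)) hprob (by positivity)
      (gaussianPosteriorDensity_sq_le hpM y) v hv)
    field_simp
    ring
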